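/- **Setting.** Let $\mathcal X$ be a measurable space and let $\mathcal X^{n\times k}$ be the space of $n\times k$ databases with the product $\sigma$-algebra. A structured Pufferfish framework $(\mathcal G,\mathcal W,\mathcal E,\Theta)$ consists of finite families $\mathcal G$ and $\mathcal W$ of measurable functions on $\mathcal X^{n\times k}$ (the private and the public functions; the values of the private functions lie in standard Borel spaces), the edge set $\mathcal E$ of a bipartite graph between $\mathcal G$ and $\mathcal W$ (we write $g\sim w$ for an edge), and a set $\Theta$ of probability measures on $\mathcal X^{n\times k}$. Put $\mathcal W^\star=\{w\in\mathcal W:\ \exists g\in\mathcal G,\ g\sim w\}$. A randomized mechanism $M$ (a Markov kernel $P_{M|X}$) is $\epsilon$-MI PP in this framework if $$\sup_{P_X\in\Theta,\ g\sim w}\mathsf I\big(g(X);M(X)\,\big|\,w(X)\big)\le\epsilon ,$$ where $X\sim P_X$ and $\mathsf I(U;V|W)=\int \mathsf D_{\mathsf{KL}}\big(P_{UV|W=c}\,\big\|\,P_{U|W=c}\otimes P_{V|W=c}\big)\,dP_W(c)$ is conditional mutual information in nats. **Theorem (Gaussian mechanism with projections).** Fix $\epsilon>0$, a structured Pufferfish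 framework $(\mathcal G,\mathcal W,\mathcal E,\Theta)$, integers $1\le\ell\le d$, $\sigma\in\mathbb R$, and a measurable query $f:\mathcal X^{n\times k}\to\mathbb R^d$ such that, for all $P_X\in\Theta$ and $w\in\mathcal W^\star$, $\mathbb E[\|f(X)\|^2\,|\,w(X)]<\infty$ almost surely. Let $\mu_{f|w}$ and $\Sigma_{f|w}$ be the mean vector and the covariance matrix of the regular conditional distribution of $f(X)$ given $w(X)$, let $\|\cdot\|$ be the Euclidean norm and $\|\cdot\|_{\mathrm{op}}$ the operator norm. For a matrix $\mathrm A\in\mathbb R^{d\times\ell}$ consider the mechanism $M(X)=\mathrm A^{\intercal}f(X)+Z$, where $Z\sim\mathcal N(0,\sigma^2\mathrm I_\ell)$ is independent of $X$. Then $M$ is $\epsilon$-MI PP in each of the following two cases (expectations and suprema take values in $[0,\infty]$): 1. $\mathrm A=[\phi_1,\dots,\phi_\ell]$ is deterministic and $$\sigma^2\ \ge\ \sup_{P_X\in\Theta,\ w\in\mathcal W^\star}\frac{\mathbb E\big[\|\Sigma_{f|w}\|_{\mathrm{op}}\big]\,\max_{1\le j\le\ell}\|\phi_j\|^2}{e^{2\epsilon/\ell}-1}.$$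 2. $\mathrm A=[\Phi_1,\dots,\Phi_\ell]$ is random, $\mathrm A$, $X$ and $Z$ are mutually independent, $\mathbb E[\|\Phi_j\|^2]=1$ and $\mathbb E[\Phi_j]=0$ for all $j=1,\dots,\ell$, and $$\sigma^2\ \ge\ \sup_{P_X\in\Theta,\ w\in\mathcal W^\star}\frac{\mathbb E\big[\|\Sigma_{f|w}\|_{\mathrm{op}}+\|\mu_{f|w}\|^2\big]}{e^{2\epsilon/\ell}-1}.$$ -/

import Mathlib

open MeasureTheory ProbabilityTheory InformationTheory
open scoped ENNReal

noncomputable section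

namespace PufferfishMI

/-- Matrices carry the product σ-algebra of their entries. -/
instance matrixMeasurableSpace {m n R : Type*} [MeasurableSpace R] :
    MeasurableSpace (Matrix m n R) :=
  inferInstanceAs (MeasurableSpace (m → n → R))

/-- The space of `n × k` databases with entries in `𝒳`. -/
abbrev Database (𝒳 : Type*) (n k : ℕ) : Type _ := Matrix (Fin n) (Fin k) 𝒳

/-- Mutual information `I(U;V) = D_KL(P_{UV} ‖ P_U ⊗ P_V)` of a pair with joint law `ρ = P_{UV}`,
in nats. -/
def mutualInfo {S Y : Type*} [MeasurableSpace S] [MeasurableSpace Y] (ρ : Measure (S × Y)) :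
    ℝ≥0∞ :=
  klDiv ρ (ρ.fst.prod ρ.snd)

/-- Conditional mutual information `I(U;V|W) = ∫ I(U;V|W=c) dP_W(c)`, where `I(U;V|W=c)` is the
mutual information of the regular conditional law of `(U,V)` given `W = c`. -/
def condMutualInfo {Ω S Y T : Type*} [MeasurableSpace Ω] [MeasurableSpace T]
    [MeasurableSpace S] [StandardBorelSpace S] [Nonempty S]
    [MeasurableSpace Y] [StandardBorelSpace Y] [Nonempty Y]
    (U : Ω → S) (V : Ω → Y) (W : Ω → T) (μ : Measure Ω) [IsFiniteMeasure μ] : ℝ≥0∞ :=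
  ∫⁻ c, mutualInfo (condDistrib (fun ω => (U ω, V ω)) W μ c) ∂(μ.map W)

/-- The mechanism `K` (a Markov kernel `P_{M|X}`) is `ε`-MI PP in the framework with private
functions `g i`, public functions `w j`, edge relation `E` and data distributions `Θ`. Under
`P ⊗ₘ K` the first coordinate is the database `X ∼ P` and the second one is `M(X)`. -/
def IsMIPP {D Y ι κ : Type*} [MeasurableSpace D]
    [MeasurableSpace Y] [StandardBorelSpace Y] [Nonempty Y]
    {S : ι → Type*} [∀ i, MeasurableSpace (S i)] [∀ i, StandardBorelSpace (S i)]
    [∀ i, Nonempty (S i)] {T : κ → Type*} [∀ j, MeasurableSpace (T j)]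
    (g : ∀ i, D → S i) (w : ∀ j, D → T j) (E : ι → κ → Prop) (Θ : Set (ProbabilityMeasure D))
    (ε : ℝ) (K : Kernel D Y) [IsMarkovKernel K] : Prop :=
  ⨆ P ∈ Θ, ⨆ i, ⨆ j, ⨆ _ : E i j,
    condMutualInfo (fun p : D × Y => g i p.1) (fun p : D × Y => p.2) (fun p : D × Y => w j p.1)
      ((P : Measure D) ⊗ₘ K) ≤ ENNReal.ofReal ε

/-- The set `𝒲⋆` of (indices of) public functions that are joined to some private function. -/
def activePublic {ι κ : Type*} (E : ι → κ → Prop) : Set κ := {j | ∃ i, E i j}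

/-- The `j`-th column of `A`, as a vector of Euclidean space. -/
def column {d ℓ : ℕ} (A : Matrix (Fin d) (Fin ℓ) ℝ) (j : Fin ℓ) : EuclideanSpace ℝ (Fin d) :=
  WithLp.toLp 2 (A.col j)

/-- The Gaussian law `N(0, σ² I_ℓ)`. -/
def isotropicGaussian (ℓ : ℕ) (σ : ℝ) : Measure (EuclideanSpace ℝ (Fin ℓ)) :=
  multivariateGaussian 0 (σ ^ 2 • (1 : Matrix (Fin ℓ) (Fin ℓ) ℝ))

instance (ℓ : ℕ) (σ : ℝ) : IsProbabilityMeasure (isotropicGaussian ℓ σ) := by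
  unfold isotropicGaussian; infer_instance

/-- The map `(x, (A, z)) ↦ Aᵀ f(x) + z`. -/
def projectedOutput {D : Type*} {d ℓ : ℕ} (f : D → EuclideanSpace ℝ (Fin d))
    (p : D × (Matrix (Fin d) (Fin ℓ) ℝ × EuclideanSpace ℝ (Fin ℓ))) : EuclideanSpace ℝ (Fin ℓ) :=
  WithLp.toLp 2 (p.2.1.transpose.mulVec (f p.1).ofLp) + p.2.2

lemma measurable_projectedOutput {D : Type*} [MeasurableSpace D] {d ℓ : ℕ}
    {f : D → EuclideanSpace ℝ (Fin d)} (hf : Measurable f) :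
    Measurable (projectedOutput (ℓ := ℓ) f) := by
  unfold projectedOutput
  refine Measurable.add ?_ (by fun_prop)
  refine (WithLp.measurable_toLp 2 _).comp (measurable_pi_lambda _ fun j => ?_)
  simp only [Matrix.mulVec, dotProduct, Matrix.transpose_apply]
  refine Finset.measurable_sum _ fun i _ => Measurable.mul ?_ ?_
  · have h : Measurable (fun A : Matrix (Fin d) (Fin ℓ) ℝ => A i j) :=
      (measurable_pi_apply j).comp (measurable_pi_apply i)
    exact h.comp (by fun_prop)
  · fun_prop

/-- The mechanism `M(X) = Aᵀ f(X) + Z` as a Markov kernel: given the database, the matrix `A ∼ ν`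
and the noise `Z ∼ N(0, σ² I_ℓ)` are drawn independently (of each other and of the database).
A deterministic matrix `A` is the case `ν = dirac A`. -/
def projectedGaussianMechanism {D : Type*} [MeasurableSpace D] {d ℓ : ℕ}
    (f : D → EuclideanSpace ℝ (Fin d)) (_hf : Measurable f)
    (ν : Measure (Matrix (Fin d) (Fin ℓ) ℝ)) (σ : ℝ) : Kernel D (EuclideanSpace ℝ (Fin ℓ)) :=
  (Kernel.id ×ₖ Kernel.const D (ν.prod (isotropicGaussian ℓ σ))).map (projectedOutput f)

instance {D : Type*} [MeasurableSpace D] {d ℓ : ℕ} (f : D → EuclideanSpace ℝ (Fin d))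
    (hf : Measurable f) (ν : Measure (Matrix (Fin d) (Fin ℓ) ℝ)) [IsProbabilityMeasure ν] (σ : ℝ) :
    IsMarkovKernel (projectedGaussianMechanism f hf ν σ) := by
  unfold projectedGaussianMechanism
  exact Kernel.IsMarkovKernel.map _ (measurable_projectedOutput hf)

/-- Mean vector of a law on `ℝ^d`. -/
def meanVector {d : ℕ} (ρ : Measure (EuclideanSpace ℝ (Fin d))) : EuclideanSpace ℝ (Fin d) :=
  ∫ y, y ∂ρ

/-- Covariance matrix of a law on `ℝ^d`. -/
def covarianceMatrix {d : ℕ} (ρ : Measure (EuclideanSpace ℝ (Fin d))) :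
    Matrix (Fin d) (Fin d) ℝ :=
  Matrix.of fun i j => cov[fun y => y i, fun y => y j; ρ]

/-- Operator norm of a matrix with respect to Euclidean norms. -/
def opENorm {d : ℕ} (B : Matrix (Fin d) (Fin d) ℝ) : ℝ≥0∞ :=
  ‖Matrix.toEuclideanCLM (n := Fin d) (𝕜 := ℝ) B‖ₑ

section Conditional

variable {D T : Type*} [MeasurableSpace D] [MeasurableSpace T] {d : ℕ}

/-- `μ_{f|w}` at the value `w(X) = c`: the mean of the regular conditional law of `f(X)`. -/
def condMean (P : Measure D) [IsFiniteMeasure P] (f : D → EuclideanSpace ℝ (Fin d)) (w : D → T)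
    (c : T) : EuclideanSpace ℝ (Fin d) :=
  meanVector (condDistrib f w P c)

/-- `Σ_{f|w}` at the value `w(X) = c`: the covariance matrix of the regular conditional law of
`f(X)`. -/
def condCovariance (P : Measure D) [IsFiniteMeasure P] (f : D → EuclideanSpace ℝ (Fin d))
    (w : D → T) (c : T) : Matrix (Fin d) (Fin d) ℝ :=
  covarianceMatrix (condDistrib f w P c)

/-- Given `w(X)`, the query `f(X)` almost surely has finite conditional second moment, so that the
conditional mean and covariance exist. -/
def HasCondSecondMoment (P : Measure D) [IsFiniteMeasure P] (f : D → EuclideanSpace ℝ (Fin d))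
    (w : D → T) : Prop :=
  ∀ᵐ x ∂P, MemLp id 2 (condDistrib f w P (w x))

end Conditional

end PufferfishMI

end

open PufferfishMI

namespace PufferfishMI

-- For any probability law `Q`, `I(U;V) ≤ D(P_{UV} ‖ P_U ⊗ Q)`: the excess is `D(P_V ‖ Q)`.
-- Conditionally on `w(X) = c` the output is `Y + Z` with `Y = Aᵀ f(X)`; take `Q = N(m(c), τ² I_ℓ)`.
-- By data processing `U = g(X)` may be replaced by the whole source (`X` through `(g, f)`, together
-- with `A`), and a direct computation with Gaussian densities gives `I ≤ ℓ/2 (log (τ²/σ²) + σ²/τ² -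
-- 1) + E‖Y - m(c)‖² / (2τ²)` (`mutualInfo_gaussianChannel_le`).
--
-- The choice `τ² = σ² e^{2ε/ℓ}` does not depend on `c`, so the bound is affine in the conditional
-- deviation and can be averaged over `c` without a concavity argument. If the averaged deviation is
-- at most `ℓ σ² (e^{2ε/ℓ} - 1)`, the total is exactly `ε`
-- (`condMutualInfo_projectedGaussianMechanism_le`).
--
-- It remains to bound the deviation coordinatewise. For deterministic `A`, `m = Aᵀ μ_{f|w}` leaves
-- the variances `φ_jᵀ Σ φ_j` (`lintegral_projectVec_sub_mean_le`). For random `A`, `m = 0` leaves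
-- second moments, which bring in `‖μ_{f|w}‖²` (`lintegral_projectVec_le`).

-- Divergence bounds for mutual information.

/-- The mutual information is at most the divergence to any product `P_U ⊗ Q`. -/
lemma mutualInfo_le_klDiv_prod {S Y : Type*} [MeasurableSpace S] [StandardBorelSpace S] [Nonempty S]
    [MeasurableSpace Y] (ρ : Measure (S × Y)) [IsProbabilityMeasure ρ]
    (Q : Measure Y) [IsProbabilityMeasure Q] :
    mutualInfo ρ ≤ klDiv ρ (ρ.fst.prod Q) := by
  -- The chain rule splits off the first marginal, so the coordinates are swapped to compare `ρ.snd`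
  -- with `Q`; the divergence is invariant under swapping.
  set ρ' : Measure (Y × S) := ρ.map Prod.swap with hρ'
  have hfst : ρ'.fst = ρ.snd := by rw [hρ', Measure.fst_map_swap]
  have hdis : ρ.snd ⊗ₘ ρ'.condKernel = ρ' := by rw [← hfst, Measure.disintegrate]
  have hback : ρ'.map Prod.swap = ρ := by
    rw [hρ', Measure.map_map measurable_swap measurable_swap, Prod.swap_swap_eq, Measure.map_id]
  have hchain := klDiv_compProd_eq_add ρ.snd Q ρ'.condKernel (Kernel.const Y ρ.fst)
  rw [Measure.compProd_const, Measure.compProd_const, hdis] at hchain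
  calc mutualInfo ρ
      = klDiv (ρ'.map Prod.swap) ((ρ.snd.prod ρ.fst).map Prod.swap) := by
        rw [hback, Measure.prod_swap, mutualInfo]
    _ ≤ klDiv ρ' (ρ.snd.prod ρ.fst) := klDiv_map_le _ _ measurable_swap
    _ ≤ klDiv ρ' (Q.prod ρ.fst) := hchain ▸ le_add_self
    _ = klDiv (ρ.map Prod.swap) ((ρ.fst.prod Q).map Prod.swap) := by rw [Measure.prod_swap]
    _ ≤ klDiv ρ (ρ.fst.prod Q) := klDiv_map_le _ _ measurable_swap

/-- A product law has zero mutual information. -/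
lemma mutualInfo_prod {S Y : Type*} [MeasurableSpace S] [MeasurableSpace Y]
    (α : Measure S) [IsProbabilityMeasure α] (β : Measure Y) [IsProbabilityMeasure β] :
    mutualInfo (α.prod β) = 0 := by
  rw [mutualInfo, Measure.fst_prod, Measure.snd_prod, klDiv_self]

/-- The divergence of a probability measure with log-density `L`. -/
lemma klDiv_withDensity_exp {Ω : Type*} [MeasurableSpace Ω] (ν : Measure Ω) [IsProbabilityMeasure ν]
    {L : Ω → ℝ} (hL : Measurable L)
    [IsProbabilityMeasure (ν.withDensity fun x => ENNReal.ofReal (Real.exp (L x)))]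
    (hint : Integrable L (ν.withDensity fun x => ENNReal.ofReal (Real.exp (L x)))) :
    klDiv (ν.withDensity fun x => ENNReal.ofReal (Real.exp (L x))) ν =
      ENNReal.ofReal (∫ x, L x ∂(ν.withDensity fun x => ENNReal.ofReal (Real.exp (L x)))) := by
  set μ := ν.withDensity fun x => ENNReal.ofReal (Real.exp (L x)) with hμ
  have hac : μ ≪ ν := withDensity_absolutelyContinuous _ _
  have hllr : llr μ ν =ᵐ[μ] L := by
    refine hac.ae_le ?_
    filter_upwards [Measure.rnDeriv_withDensity ν (f := fun x => ENNReal.ofReal (Real.exp (L x)))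
      (by fun_prop)] with x hx
    rw [llr, hx, ENNReal.toReal_ofReal (Real.exp_pos _).le, Real.log_exp]
  -- `klDiv` carries a correction by the difference of total masses, which vanishes for two
  -- probability measures.
  rw [klDiv_of_ac_of_integrable hac (hint.congr hllr.symm), integral_congr_ae hllr]
  simp

-- Density and second moment of the isotropic Gaussian.

/-- Logarithm of the density of `N(0, s I_ℓ)`. -/
noncomputable def gaussianLogDensity (ℓ : ℕ) (s : ℝ) (z : EuclideanSpace ℝ (Fin ℓ)) : ℝ :=
  -(ℓ / 2) * Real.log (2 * Real.pi * s) - ‖z‖ ^ 2 / (2 * s)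

@[fun_prop]
lemma continuous_gaussianLogDensity (ℓ : ℕ) (s : ℝ) : Continuous (gaussianLogDensity ℓ s) := by
  unfold gaussianLogDensity; fun_prop

@[fun_prop]
lemma measurable_gaussianLogDensity (ℓ : ℕ) (s : ℝ) : Measurable (gaussianLogDensity ℓ s) :=
  (continuous_gaussianLogDensity ℓ s).measurable

lemma exp_gaussianLogDensity (ℓ : ℕ) (s : ℝ) (z : EuclideanSpace ℝ (Fin ℓ)) :
    Real.exp (gaussianLogDensity ℓ s z) =
      Real.exp (-(ℓ / 2) * Real.log (2 * Real.pi * s)) * Real.exp (-(1 / (2 * s)) * ‖z‖ ^ 2) := by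
  rw [gaussianLogDensity, sub_eq_add_neg, Real.exp_add]
  congr 2; ring

lemma integral_exp_neg_mul_sq_norm_euclidean {ℓ : ℕ} {s : ℝ} (hs : 0 < s) :
    ∫ z : EuclideanSpace ℝ (Fin ℓ), Real.exp (-(1 / (2 * s)) * ‖z‖ ^ 2) =
      Real.exp ((ℓ / 2) * Real.log (2 * Real.pi * s)) := by
  rw [GaussianFourier.integral_rexp_neg_mul_sq_norm (by positivity),
    Real.rpow_def_of_pos (by positivity)]
  simp only [finrank_euclideanSpace, Fintype.card_fin]
  rw [mul_comm]
  congr 3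
  field_simp

lemma integrable_exp_gaussianLogDensity {ℓ : ℕ} {s : ℝ} (hs : 0 < s) :
    Integrable fun z : EuclideanSpace ℝ (Fin ℓ) => Real.exp (gaussianLogDensity ℓ s z) := by
  simp_rw [exp_gaussianLogDensity]
  refine Integrable.const_mul ?_ _
  -- The Bochner integral of a non-integrable function is `0`, so a nonzero value proves
  -- integrability.
  refine Integrable.of_integral_ne_zero ?_
  rw [integral_exp_neg_mul_sq_norm_euclidean hs]
  positivity

/-- The Gaussian law `N(0, σ² I_ℓ)` has the expected Lebesgue density. -/
lemma isotropicGaussian_eq_withDensity (ℓ : ℕ) {σ : ℝ} (hσ : σ ≠ 0) :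
    isotropicGaussian ℓ σ =
      volume.withDensity fun z => ENNReal.ofReal (Real.exp (gaussianLogDensity ℓ (σ ^ 2) z)) := by
  have hs : 0 < σ ^ 2 := by positivity
  have : IsFiniteMeasure ((volume : Measure (EuclideanSpace ℝ (Fin ℓ))).withDensity
      fun z => ENNReal.ofReal (Real.exp (gaussianLogDensity ℓ (σ ^ 2) z))) :=
    isFiniteMeasure_withDensity_ofReal (integrable_exp_gaussianLogDensity hs).2
  -- Both characteristic functions equal `exp (-σ² ‖t‖² / 2)`; the Lebesgue side is a Gaussian
  -- Fourier integral.
  refine Measure.ext_of_charFun ?_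
  ext t
  have hpsd : (σ ^ 2 • (1 : Matrix (Fin ℓ) (Fin ℓ) ℝ)).PosSemidef := Matrix.PosSemidef.one.smul hs.le
  rw [isotropicGaussian, charFun_multivariateGaussian hpsd, charFun_apply,
    integral_withDensity_eq_integral_toReal_smul (by fun_prop) (by simp)]
  have hb : 0 < ((1 / (2 * σ ^ 2) : ℝ) : ℂ).re := by
    rw [Complex.ofReal_re]; positivity
  have key := GaussianFourier.integral_cexp_neg_mul_sq_norm_add_of_euclideanSpace hb Complex.I t
  have hpt : ∀ z : EuclideanSpace ℝ (Fin ℓ),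
      (ENNReal.ofReal (Real.exp (gaussianLogDensity ℓ (σ ^ 2) z))).toReal •
        Complex.exp (inner ℝ z t * Complex.I) =
      (Real.exp (-(ℓ / 2) * Real.log (2 * Real.pi * σ ^ 2)) : ℂ) *
        Complex.exp (-((1 / (2 * σ ^ 2) : ℝ) : ℂ) * ‖z‖ ^ 2 + Complex.I * inner ℝ t z) := by
    intro z
    rw [ENNReal.toReal_ofReal (Real.exp_pos _).le, exp_gaussianLogDensity, Complex.real_smul,
      Complex.exp_add, real_inner_comm]
    push_cast
    ring_nf
  simp_rw [hpt]
  rw [integral_const_mul, key]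
  have hnorm : ((Real.pi : ℂ) / ((1 / (2 * σ ^ 2) : ℝ) : ℂ)) ^ (Fintype.card (Fin ℓ) / 2 : ℂ) =
      (Real.exp ((ℓ / 2) * Real.log (2 * Real.pi * σ ^ 2)) : ℂ) := by
    rw [← Complex.ofReal_div,
      show (Fintype.card (Fin ℓ) / 2 : ℂ) = ((ℓ / 2 : ℝ) : ℂ) by simp,
      ← Complex.ofReal_cpow (by positivity), Real.rpow_def_of_pos (by positivity), mul_comm]
    congr 4
    field_simp
  rw [hnorm, ← mul_assoc, ← Complex.ofReal_mul, ← Real.exp_add]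
  have hdot : t.ofLp ⬝ᵥ (σ ^ 2 • (1 : Matrix (Fin ℓ) (Fin ℓ) ℝ)).mulVec t.ofLp = σ ^ 2 * ‖t‖ ^ 2 := by
    rw [Matrix.smul_mulVec, Matrix.one_mulVec, dotProduct_smul, smul_eq_mul,
      EuclideanSpace.real_norm_sq_eq]
    simp [dotProduct, sq]
  have hσc : (σ : ℂ) ≠ 0 := by exact_mod_cast hσ
  rw [hdot]
  simp only [neg_mul, neg_add_cancel, Real.exp_zero, Complex.ofReal_one, one_mul, inner_zero_right,
    Complex.ofReal_zero, zero_mul, zero_sub, Complex.I_sq]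
  congr 1
  push_cast
  field_simp
  ring

lemma memLp_id_isotropicGaussian (ℓ : ℕ) (σ : ℝ) : MemLp id 2 (isotropicGaussian ℓ σ) := by
  unfold isotropicGaussian; exact IsGaussian.memLp_two_id

lemma integrable_sq_norm_isotropicGaussian (ℓ : ℕ) (σ : ℝ) :
    Integrable (fun z => ‖z‖ ^ 2) (isotropicGaussian ℓ σ) :=
  (memLp_id_isotropicGaussian ℓ σ).integrable_norm_pow two_ne_zero

lemma integral_sq_norm_isotropicGaussian (ℓ : ℕ) (σ : ℝ) :
    ∫ z, ‖z‖ ^ 2 ∂(isotropicGaussian ℓ σ) = ℓ * σ ^ 2 := by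
  have hpsd : (σ ^ 2 • (1 : Matrix (Fin ℓ) (Fin ℓ) ℝ)).PosSemidef :=
    Matrix.PosSemidef.one.smul (sq_nonneg σ)
  have hmem : ∀ i, MemLp (fun z : EuclideanSpace ℝ (Fin ℓ) => z i) 2 (isotropicGaussian ℓ σ) :=
    fun i => (memLp_id_isotropicGaussian ℓ σ).continuousLinearMap_comp
      (EuclideanSpace.proj (𝕜 := ℝ) i)
  have hmean : ∀ i, ∫ z : EuclideanSpace ℝ (Fin ℓ), z i ∂(isotropicGaussian ℓ σ) = 0 := by
    intro i
    have := (EuclideanSpace.proj (𝕜 := ℝ) i).integral_comp_comm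
      ((memLp_id_isotropicGaussian ℓ σ).integrable one_le_two)
    simpa [isotropicGaussian] using this
  have hvar : ∀ i, ∫ z : EuclideanSpace ℝ (Fin ℓ), z i ^ 2 ∂(isotropicGaussian ℓ σ) = σ ^ 2 := by
    intro i
    have h := variance_eval_multivariateGaussian (μ := 0) hpsd i
    rw [← isotropicGaussian, variance_of_integral_eq_zero (hmem i).aemeasurable (hmean i)] at h
    simpa using h
  simp_rw [EuclideanSpace.real_norm_sq_eq]
  rw [integral_finsetSum _ fun i _ => (hmem i).integrable_sq]
  simp [hvar]

-- Information through a Gaussian channel.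

/-- `N(m, τ² I_ℓ)`, as a translate. -/
noncomputable def shiftedGaussian (ℓ : ℕ) (m : EuclideanSpace ℝ (Fin ℓ)) (τ : ℝ) :
    Measure (EuclideanSpace ℝ (Fin ℓ)) :=
  (isotropicGaussian ℓ τ).map (m + ·)

instance (ℓ : ℕ) (m : EuclideanSpace ℝ (Fin ℓ)) (τ : ℝ) :
    IsProbabilityMeasure (shiftedGaussian ℓ m τ) :=
  Measure.isProbabilityMeasure_map (by fun_prop)

/-- Adding independent Gaussian noise to `Y`: the joint law with the source has a density with
respect to the product of the law of the source and Lebesgue measure. -/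
lemma map_add_gaussian_eq_withDensity {Ω : Type*} [MeasurableSpace Ω] (π : Measure Ω)
    [IsProbabilityMeasure π] {ℓ : ℕ} {Y : Ω → EuclideanSpace ℝ (Fin ℓ)} (hY : Measurable Y)
    {σ : ℝ} (hσ : σ ≠ 0) :
    (π.prod (isotropicGaussian ℓ σ)).map (fun p => (p.1, Y p.1 + p.2)) =
      (π.prod volume).withDensity
        fun p => ENNReal.ofReal (Real.exp (gaussianLogDensity ℓ (σ ^ 2) (p.2 - Y p.1))) := by
  -- The shear `(ω, z) ↦ (ω, Y ω + z)` preserves `π ⊗ volume` by translation invariance, so the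
  -- noise density is merely transported along it.
  have hpres : MeasurePreserving (fun p : Ω × EuclideanSpace ℝ (Fin ℓ) => (p.1, Y p.1 + p.2))
      (π.prod volume) (π.prod volume) :=
    (MeasurePreserving.id π).skew_product (g := fun ω z => Y ω + z) (by fun_prop)
      (Filter.Eventually.of_forall fun ω => (measurePreserving_add_left volume (Y ω)).map_eq)
  rw [isotropicGaussian_eq_withDensity ℓ hσ, prod_withDensity_right (by fun_prop)]
  refine Measure.ext_of_lintegral _ fun h hh => ?_
  have hcomp : Measurable fun p : Ω × EuclideanSpace ℝ (Fin ℓ) => h (p.1, Y p.1 + p.2) :=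
    hh.comp hpres.measurable
  rw [lintegral_map hh hpres.measurable,
    lintegral_withDensity_eq_lintegral_mul _ (by fun_prop) hcomp,
    lintegral_withDensity_eq_lintegral_mul _ (by fun_prop) hh]
  conv_rhs => rw [← hpres.lintegral_comp (by fun_prop)]
  simp

/-- Divergence of a Gaussian channel with input `Y` from an isotropic Gaussian output law. -/
lemma klDiv_map_add_gaussian_le {Ω : Type*} [MeasurableSpace Ω] (π : Measure Ω)
    [IsProbabilityMeasure π] {ℓ : ℕ} {Y : Ω → EuclideanSpace ℝ (Fin ℓ)} (hY : Measurable Y)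
    (m : EuclideanSpace ℝ (Fin ℓ)) {σ τ : ℝ} (hσ : σ ≠ 0) (hτ : τ ≠ 0) :
    klDiv ((π.prod (isotropicGaussian ℓ σ)).map (fun p => (p.1, Y p.1 + p.2)))
        (π.prod (shiftedGaussian ℓ m τ)) ≤
      ENNReal.ofReal (ℓ / 2 * (Real.log (τ ^ 2 / σ ^ 2) + σ ^ 2 / τ ^ 2 - 1)) +
        ENNReal.ofReal (1 / (2 * τ ^ 2)) * ∫⁻ ω, ‖Y ω - m‖ₑ ^ 2 ∂π := by
  have hτ2 : 0 < τ ^ 2 := by positivity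
  have hσ2 : 0 < σ ^ 2 := by positivity
  -- With infinite deviation the right side is `∞`; otherwise all the integrals below are finite.
  by_cases hfin : ∫⁻ ω, ‖Y ω - m‖ₑ ^ 2 ∂π = ∞
  · rw [hfin, ENNReal.mul_top (by rw [Ne, ENNReal.ofReal_eq_zero, not_le]; positivity)]
    simp
  have hYL : MemLp (fun ω => Y ω - m) 2 π := by
    refine ⟨by fun_prop, ?_⟩
    rw [eLpNorm_lt_top_iff_lintegral_rpow_enorm_lt_top two_ne_zero ENNReal.ofNat_ne_top]
    simpa using lt_of_le_of_ne le_top hfin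
  set G := isotropicGaussian ℓ σ with hG
  set Q := shiftedGaussian ℓ m τ with hQ
  have hQprod : π.prod Q = (π.prod volume).withDensity
      fun p => ENNReal.ofReal (Real.exp (gaussianLogDensity ℓ (τ ^ 2) (p.2 - m))) := by
    -- The reference law is itself a Gaussian channel, with constant input `m`.
    have h := map_add_gaussian_eq_withDensity π (ℓ := ℓ) (Y := fun _ => m) (by fun_prop) hτ
    rw [← h, hQ, shiftedGaussian]
    conv_lhs => rw [← Measure.map_id (μ := π)]
    rw [Measure.map_prod_map _ _ measurable_id (by fun_prop)]
    rfl
  -- The log-likelihood ratio: both laws have densities with respect to `π ⊗ volume`.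
  set L : Ω × EuclideanSpace ℝ (Fin ℓ) → ℝ := fun p =>
    gaussianLogDensity ℓ (σ ^ 2) (p.2 - Y p.1) - gaussianLogDensity ℓ (τ ^ 2) (p.2 - m) with hL
  have hLm : Measurable L := by fun_prop
  set J := (π.prod G).map (fun p => (p.1, Y p.1 + p.2)) with hJ
  have hJprob : IsProbabilityMeasure J := Measure.isProbabilityMeasure_map (by fun_prop)
  have hJd : J = (π.prod Q).withDensity fun p => ENNReal.ofReal (Real.exp (L p)) := by
    rw [hQprod, ← withDensity_mul _ (by fun_prop) (by fun_prop), hJ, hG,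
      map_add_gaussian_eq_withDensity π hY hσ]
    congr 1
    ext p
    rw [Pi.mul_apply, ← ENNReal.ofReal_mul (Real.exp_pos _).le, ← Real.exp_add, hL]
    simp
  have hLpt : ∀ p : Ω × EuclideanSpace ℝ (Fin ℓ), L (p.1, Y p.1 + p.2) =
      ℓ / 2 * Real.log (τ ^ 2 / σ ^ 2) + 1 / (2 * τ ^ 2) * (‖Y p.1 - m‖ ^ 2 +
        2 * inner ℝ (Y p.1 - m) p.2 + ‖p.2‖ ^ 2) - 1 / (2 * σ ^ 2) * ‖p.2‖ ^ 2 := by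
    intro p
    rw [hL]
    simp only [gaussianLogDensity, add_sub_cancel_left]
    rw [← norm_add_sq_real, Real.log_div hτ2.ne' hσ2.ne',
      Real.log_mul (by positivity) hτ2.ne', Real.log_mul (by positivity) hσ2.ne',
      show Y p.1 + p.2 - m = Y p.1 - m + p.2 by abel]
    ring
  have hY2 : Integrable (fun ω => ‖Y ω - m‖ ^ 2) π := hYL.integrable_norm_pow two_ne_zero
  have hz2 := integrable_sq_norm_isotropicGaussian ℓ σ
  rw [← hG] at hz2
  have i1 : Integrable (fun p : Ω × EuclideanSpace ℝ (Fin ℓ) => ‖Y p.1 - m‖ ^ 2) (π.prod G) :=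
    hY2.comp_fst G
  have i3 : Integrable (fun p : Ω × EuclideanSpace ℝ (Fin ℓ) => ‖p.2‖ ^ 2) (π.prod G) :=
    hz2.comp_snd π
  have i2 : Integrable (fun p : Ω × EuclideanSpace ℝ (Fin ℓ) => inner ℝ (Y p.1 - m) p.2)
      (π.prod G) := by
    refine (i1.add i3).mono' (by fun_prop) (Filter.Eventually.of_forall fun p => ?_)
    have h1 := norm_inner_le_norm (𝕜 := ℝ) (Y p.1 - m) p.2
    simp only [Pi.add_apply]
    nlinarith [sq_nonneg (‖Y p.1 - m‖ - ‖p.2‖), sq_nonneg ‖Y p.1 - m‖, sq_nonneg ‖p.2‖]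
  have hint : Integrable (fun p : Ω × EuclideanSpace ℝ (Fin ℓ) => L (p.1, Y p.1 + p.2))
      (π.prod G) := by
    simp_rw [hLpt]
    exact ((integrable_const _).add (((i1.add (i2.const_mul 2)).add i3).const_mul _)).sub
      (i3.const_mul _)
  have hval : ∫ p, L p ∂J = ℓ / 2 * (Real.log (τ ^ 2 / σ ^ 2) + σ ^ 2 / τ ^ 2 - 1) +
      1 / (2 * τ ^ 2) * ∫ ω, ‖Y ω - m‖ ^ 2 ∂π := by
    have e1 : ∫ p, ‖Y p.1 - m‖ ^ 2 ∂(π.prod G) = ∫ ω, ‖Y ω - m‖ ^ 2 ∂π := by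
      rw [integral_prod _ i1]; simp
    have e3 : ∫ p, ‖p.2‖ ^ 2 ∂(π.prod G) = ℓ * σ ^ 2 := by
      rw [integral_prod _ i3]; simp [hG, integral_sq_norm_isotropicGaussian]
    -- The cross term vanishes because the noise is centred and independent of the source.
    have e2 : ∫ p, inner ℝ (Y p.1 - m) p.2 ∂(π.prod G) = 0 := by
      rw [integral_prod _ i2]
      refine integral_eq_zero_of_ae (Filter.Eventually.of_forall fun ω => ?_)
      have h := integral_inner (𝕜 := ℝ)
        ((memLp_id_isotropicGaussian ℓ σ).integrable one_le_two) (Y ω - m)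
      have hmean : ∫ z, id z ∂(isotropicGaussian ℓ σ) = 0 := by simp [isotropicGaussian]
      simp only [hmean, inner_zero_right] at h
      exact h
    rw [hJ, integral_map (by fun_prop) (by fun_prop)]
    simp_rw [hLpt]
    have i12 : Integrable (fun p : Ω × EuclideanSpace ℝ (Fin ℓ) =>
        ‖Y p.1 - m‖ ^ 2 + 2 * inner ℝ (Y p.1 - m) p.2) (π.prod G) := i1.add (i2.const_mul 2)
    have i123 : Integrable (fun p : Ω × EuclideanSpace ℝ (Fin ℓ) => 1 / (2 * τ ^ 2) *
        (‖Y p.1 - m‖ ^ 2 + 2 * inner ℝ (Y p.1 - m) p.2 + ‖p.2‖ ^ 2)) (π.prod G) :=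
      (i12.add i3).const_mul _
    have i0123 : Integrable (fun p : Ω × EuclideanSpace ℝ (Fin ℓ) =>
        ℓ / 2 * Real.log (τ ^ 2 / σ ^ 2) + 1 / (2 * τ ^ 2) *
        (‖Y p.1 - m‖ ^ 2 + 2 * inner ℝ (Y p.1 - m) p.2 + ‖p.2‖ ^ 2)) (π.prod G) :=
      (integrable_const _).add i123
    rw [integral_sub i0123 (i3.const_mul _),
      integral_add (integrable_const _) i123]
    simp only [integral_const_mul]
    rw [integral_add i12 i3, integral_add i1 (i2.const_mul 2)]
    simp only [integral_const_mul, e1, e2, e3, integral_const, probReal_univ, smul_eq_mul]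
    field_simp
    ring
  have hprob' : IsProbabilityMeasure
      ((π.prod Q).withDensity fun p => ENNReal.ofReal (Real.exp (L p))) := hJd ▸ hJprob
  have hkl : klDiv J (π.prod Q) = ENNReal.ofReal (∫ p, L p ∂J) := by
    rw [hJd]
    refine klDiv_withDensity_exp _ hLm ?_
    rw [← hJd, hJ]
    exact (integrable_map_measure (by fun_prop) (by fun_prop)).2 hint
  rw [hkl, hval]
  refine ENNReal.ofReal_add_le.trans (add_le_add le_rfl ?_)
  rw [ENNReal.ofReal_mul (by positivity), ofReal_integral_eq_lintegral_ofReal hY2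
    (Filter.Eventually.of_forall fun _ => by positivity)]
  gcongr with ω
  rw [ENNReal.ofReal_pow (norm_nonneg _), ofReal_norm]

/-- Mutual information over a Gaussian channel with input `Y`. -/
lemma mutualInfo_gaussianChannel_le {Ω S : Type*} [MeasurableSpace Ω] [MeasurableSpace S]
    [StandardBorelSpace S] [Nonempty S] (π : Measure Ω) [IsProbabilityMeasure π] {ℓ : ℕ}
    {U : Ω → S} (hU : Measurable U) {Y : Ω → EuclideanSpace ℝ (Fin ℓ)} (hY : Measurable Y)
    (m : EuclideanSpace ℝ (Fin ℓ)) {σ τ : ℝ} (hσ : σ ≠ 0) (hτ : τ ≠ 0) :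
    mutualInfo ((π.prod (isotropicGaussian ℓ σ)).map (fun p => (U p.1, Y p.1 + p.2))) ≤
      ENNReal.ofReal (ℓ / 2 * (Real.log (τ ^ 2 / σ ^ 2) + σ ^ 2 / τ ^ 2 - 1)) +
        ENNReal.ofReal (1 / (2 * τ ^ 2)) * ∫⁻ ω, ‖Y ω - m‖ₑ ^ 2 ∂π := by
  refine le_trans ?_ (klDiv_map_add_gaussian_le π hY m hσ hτ)
  have hprob : IsProbabilityMeasure
      ((π.prod (isotropicGaussian ℓ σ)).map (fun p => (U p.1, Y p.1 + p.2))) :=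
    Measure.isProbabilityMeasure_map (by fun_prop)
  have hprob' : IsProbabilityMeasure
      ((π.prod (isotropicGaussian ℓ σ)).map (fun p => (p.1, Y p.1 + p.2))) :=
    Measure.isProbabilityMeasure_map (by fun_prop)
  refine (mutualInfo_le_klDiv_prod _ (shiftedGaussian ℓ m τ)).trans ?_
  -- Data processing along `U × id`: forgetting all of the source except `U` cannot increase the
  -- divergence.
  have hmap := klDiv_map_le (μ := (π.prod (isotropicGaussian ℓ σ)).map
    (fun p => (p.1, Y p.1 + p.2))) (ν := π.prod (shiftedGaussian ℓ m τ))
    (g := Prod.map U id) (by fun_prop)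
  rw [Measure.map_map (by fun_prop) (by fun_prop)] at hmap
  have hfst : ((π.prod (isotropicGaussian ℓ σ)).map (fun p => (U p.1, Y p.1 + p.2))).fst =
      π.map U := by
    rw [Measure.fst_map_prodMk (by fun_prop)]
    change (π.prod (isotropicGaussian ℓ σ)).map (U ∘ Prod.fst) = _
    rw [← Measure.map_map hU measurable_fst, Measure.map_fst_prod]
    simp
  rw [← Measure.map_prod_map _ _ hU measurable_id, Measure.map_id] at hmap
  rw [hfst]
  exact hmap

/-- A channel whose input is almost surely constant carries no information. -/
lemma mutualInfo_gaussianChannel_of_ae_const {Ω S : Type*} [MeasurableSpace Ω] [MeasurableSpace S]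
    (π : Measure Ω) [IsProbabilityMeasure π] {ℓ : ℕ}
    {U : Ω → S} (hU : Measurable U) {Y : Ω → EuclideanSpace ℝ (Fin ℓ)}
    {m : EuclideanSpace ℝ (Fin ℓ)} (hm : ∀ᵐ ω ∂π, Y ω = m) (σ : ℝ) :
    mutualInfo ((π.prod (isotropicGaussian ℓ σ)).map (fun p => (U p.1, Y p.1 + p.2))) = 0 := by
  have hae : ∀ᵐ p ∂(π.prod (isotropicGaussian ℓ σ)), Y p.1 = m :=
    Measure.quasiMeasurePreserving_fst.ae hm
  have hcongr : (π.prod (isotropicGaussian ℓ σ)).map (fun p => (U p.1, Y p.1 + p.2)) =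
      (π.map U).prod (shiftedGaussian ℓ m σ) := by
    rw [shiftedGaussian, Measure.map_prod_map _ _ hU (by fun_prop)]
    refine Measure.map_congr ?_
    filter_upwards [hae] with p hp
    simp [hp, Prod.map]
  have := Measure.isProbabilityMeasure_map (μ := π) hU.aemeasurable
  rw [hcongr, mutualInfo_prod]

-- Second moments of projected vectors.

/-- The vector `Aᵀ y`. -/
noncomputable def projectVec {d ℓ : ℕ} (A : Matrix (Fin d) (Fin ℓ) ℝ)
    (y : EuclideanSpace ℝ (Fin d)) : EuclideanSpace ℝ (Fin ℓ) :=
  WithLp.toLp 2 (A.transpose.mulVec y.ofLp)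

lemma projectVec_apply {d ℓ : ℕ} (A : Matrix (Fin d) (Fin ℓ) ℝ) (y : EuclideanSpace ℝ (Fin d))
    (r : Fin ℓ) : projectVec A y r = inner ℝ (column A r) y := by
  simp [projectVec, column, Matrix.mulVec, dotProduct, PiLp.inner_apply, mul_comm]

lemma projectVec_sub {d ℓ : ℕ} (A : Matrix (Fin d) (Fin ℓ) ℝ) (y z : EuclideanSpace ℝ (Fin d)) :
    projectVec A (y - z) = projectVec A y - projectVec A z := by
  ext r
  simp [projectVec_apply, inner_sub_right]

@[fun_prop]
lemma measurable_projectVec {d ℓ : ℕ} :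
    Measurable fun p : Matrix (Fin d) (Fin ℓ) ℝ × EuclideanSpace ℝ (Fin d) =>
      projectVec p.1 p.2 := by
  have h := measurable_projectedOutput (D := EuclideanSpace ℝ (Fin d)) (ℓ := ℓ) measurable_id
  have h' : Measurable fun p : Matrix (Fin d) (Fin ℓ) ℝ × EuclideanSpace ℝ (Fin d) =>
      (p.2, (p.1, (0 : EuclideanSpace ℝ (Fin ℓ)))) := by fun_prop
  convert h.comp h' using 2 with p
  simp [projectedOutput, projectVec]

lemma measurable_column {d ℓ : ℕ} (r : Fin ℓ) :
    Measurable fun A : Matrix (Fin d) (Fin ℓ) ℝ => column A r := by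
  refine (WithLp.measurable_toLp 2 _).comp (measurable_pi_lambda _ fun i => ?_)
  exact (measurable_pi_apply r).comp (measurable_pi_apply i)

lemma enorm_sq_eq_sum {ℓ : ℕ} (z : EuclideanSpace ℝ (Fin ℓ)) : ‖z‖ₑ ^ 2 = ∑ r, ‖z r‖ₑ ^ 2 := by
  rw [← ofReal_norm, ← ENNReal.ofReal_pow (norm_nonneg _), EuclideanSpace.norm_sq_eq,
    ENNReal.ofReal_sum_of_nonneg fun _ _ => by positivity]
  simp_rw [ENNReal.ofReal_pow (norm_nonneg _), ofReal_norm]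

section Moments

variable {d : ℕ} {ρ : Measure (EuclideanSpace ℝ (Fin d))}

lemma memLp_inner (hρ : MemLp id 2 ρ) (φ : EuclideanSpace ℝ (Fin d)) :
    MemLp (fun y => inner ℝ φ y) 2 ρ :=
  hρ.continuousLinearMap_comp (innerSL ℝ φ)

variable [IsProbabilityMeasure ρ]

lemma integral_inner_eq_inner_meanVector (hρ : MemLp id 2 ρ) (φ : EuclideanSpace ℝ (Fin d)) :
    ∫ y, inner ℝ φ y ∂ρ = inner ℝ φ (meanVector ρ) :=
  integral_inner (hρ.integrable one_le_two) φ

/-- The variance of `⟨φ, y⟩` is the quadratic form of the covariance matrix at `φ`, to which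
Cauchy–Schwarz applies. -/
lemma variance_inner_le (hρ : MemLp id 2 ρ) (φ : EuclideanSpace ℝ (Fin d)) :
    Var[fun y => inner ℝ φ y; ρ] ≤
      ‖Matrix.toEuclideanCLM (n := Fin d) (𝕜 := ℝ) (covarianceMatrix ρ)‖ * ‖φ‖ ^ 2 := by
  have hmem : ∀ i, MemLp (fun y : EuclideanSpace ℝ (Fin d) => φ i * y i) 2 ρ := fun i =>
    (hρ.continuousLinearMap_comp (EuclideanSpace.proj (𝕜 := ℝ) i)).const_mul (φ i)
  have hvar : Var[fun y => inner ℝ φ y; ρ] =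
      inner ℝ φ (Matrix.toEuclideanCLM (n := Fin d) (𝕜 := ℝ) (covarianceMatrix ρ) φ) := by
    have hsum : (fun y : EuclideanSpace ℝ (Fin d) => inner ℝ φ y) = fun y => ∑ i, φ i * y i := by
      ext y; simp [PiLp.inner_apply, mul_comm]
    rw [hsum, variance_fun_sum' fun i _ => hmem i]
    simp_rw [covariance_const_mul_left, covariance_const_mul_right]
    simp only [PiLp.inner_apply, Matrix.ofLp_toEuclideanCLM, Matrix.mulVec, dotProduct,
      covarianceMatrix, Matrix.of_apply]
    refine Finset.sum_congr rfl fun i _ => ?_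
    simp [Finset.sum_mul]
    exact Finset.sum_congr rfl fun j _ => by ring
  rw [hvar]
  refine (real_inner_le_norm _ _).trans ?_
  have := (Matrix.toEuclideanCLM (n := Fin d) (𝕜 := ℝ) (covarianceMatrix ρ)).le_opNorm φ
  nlinarith [norm_nonneg φ]

lemma lintegral_inner_sub_mean_le (hρ : MemLp id 2 ρ) (φ : EuclideanSpace ℝ (Fin d)) :
    ∫⁻ y, ‖inner ℝ φ (y - meanVector ρ)‖ₑ ^ 2 ∂ρ ≤ opENorm (covarianceMatrix ρ) * ‖φ‖ₑ ^ 2 := by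
  have h : evariance (fun y => inner ℝ φ y) ρ =
      ∫⁻ y, ‖inner ℝ φ (y - meanVector ρ)‖ₑ ^ 2 ∂ρ := by
    rw [evariance, integral_inner_eq_inner_meanVector hρ]
    simp_rw [inner_sub_right]
  rw [← h, ← (memLp_inner hρ φ).ofReal_variance_eq]
  refine (ENNReal.ofReal_le_ofReal (variance_inner_le hρ φ)).trans_eq ?_
  rw [ENNReal.ofReal_mul (norm_nonneg _), ENNReal.ofReal_pow (norm_nonneg _), ofReal_norm,
    ofReal_norm, opENorm]

/-- The second moment is variance plus squared mean; the mean `⟨φ, meanVector ρ⟩` is controlled by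
Cauchy–Schwarz. -/
lemma lintegral_inner_le (hρ : MemLp id 2 ρ) (φ : EuclideanSpace ℝ (Fin d)) :
    ∫⁻ y, ‖inner ℝ φ y‖ₑ ^ 2 ∂ρ ≤
      (opENorm (covarianceMatrix ρ) + ‖meanVector ρ‖ₑ ^ 2) * ‖φ‖ₑ ^ 2 := by
  have hmem := memLp_inner hρ φ
  have h : ∫⁻ y, ‖inner ℝ φ y‖ₑ ^ 2 ∂ρ = ENNReal.ofReal (∫ y, (inner ℝ φ y) ^ 2 ∂ρ) := by
    rw [ofReal_integral_eq_lintegral_ofReal hmem.integrable_sq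
      (Filter.Eventually.of_forall fun _ => by positivity)]
    refine lintegral_congr fun y => ?_
    rw [← ofReal_norm, ← ENNReal.ofReal_pow (norm_nonneg _), Real.norm_eq_abs, sq_abs]
  have hv := variance_eq_sub hmem
  have hle := variance_inner_le hρ φ
  have hm : (inner ℝ φ (meanVector ρ)) ^ 2 ≤ ‖meanVector ρ‖ ^ 2 * ‖φ‖ ^ 2 := by
    rw [← mul_pow, sq_le_sq, abs_of_nonneg (by positivity : 0 ≤ ‖meanVector ρ‖ * ‖φ‖), mul_comm]
    exact abs_real_inner_le_norm _ _
  rw [integral_inner_eq_inner_meanVector hρ] at hv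
  simp only [Pi.pow_apply] at hv
  rw [h]
  calc _ ≤ ENNReal.ofReal ((‖Matrix.toEuclideanCLM (n := Fin d) (𝕜 := ℝ) (covarianceMatrix ρ)‖ +
        ‖meanVector ρ‖ ^ 2) * ‖φ‖ ^ 2) := ENNReal.ofReal_le_ofReal (by linarith)
    _ = _ := by
      rw [ENNReal.ofReal_mul (by positivity), ENNReal.ofReal_add (norm_nonneg _) (by positivity),
        ENNReal.ofReal_pow (norm_nonneg _), ENNReal.ofReal_pow (norm_nonneg _), ofReal_norm,
        ofReal_norm, ofReal_norm, opENorm]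

/-- The squared norm splits over the `ℓ` columns, each contributing the variance of one inner
product. -/
lemma lintegral_projectVec_sub_mean_le (hρ : MemLp id 2 ρ) {ℓ : ℕ}
    (A : Matrix (Fin d) (Fin ℓ) ℝ) :
    ∫⁻ y, ‖projectVec A y - projectVec A (meanVector ρ)‖ₑ ^ 2 ∂ρ ≤
      ℓ * (⨆ r, ‖column A r‖ₑ ^ 2) * opENorm (covarianceMatrix ρ) := by
  simp_rw [← projectVec_sub, enorm_sq_eq_sum (projectVec _ _), projectVec_apply]
  rw [lintegral_finsetSum _ fun r _ => by fun_prop]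
  calc _ ≤ ∑ _r : Fin ℓ, (⨆ r, ‖column A r‖ₑ ^ 2) * opENorm (covarianceMatrix ρ) := by
        refine Finset.sum_le_sum fun r _ => (lintegral_inner_sub_mean_le hρ _).trans ?_
        rw [mul_comm]
        gcongr
        exact le_iSup (fun r => ‖column A r‖ₑ ^ 2) r
    _ = _ := by simp [mul_assoc]

lemma lintegral_projectVec_le (hρ : MemLp id 2 ρ) {ℓ : ℕ}
    (ν : Measure (Matrix (Fin d) (Fin ℓ) ℝ)) [SFinite ν]
    (hν : ∀ r, ∫⁻ A, ‖column A r‖ₑ ^ 2 ∂ν = 1) :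
    ∫⁻ y, ∫⁻ A, ‖projectVec A y‖ₑ ^ 2 ∂ν ∂ρ ≤
      ℓ * (opENorm (covarianceMatrix ρ) + ‖meanVector ρ‖ₑ ^ 2) := by
  have hc := fun r => measurable_column (d := d) (ℓ := ℓ) r
  -- With `A` fixed the columns are deterministic; their squared norms are averaged only at the end.
  rw [lintegral_lintegral_swap (by fun_prop)]
  calc _ ≤ ∫⁻ A, (opENorm (covarianceMatrix ρ) + ‖meanVector ρ‖ₑ ^ 2) *
        ∑ r, ‖column A r‖ₑ ^ 2 ∂ν := by
        refine lintegral_mono fun A => ?_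
        simp_rw [enorm_sq_eq_sum (projectVec _ _), projectVec_apply]
        rw [lintegral_finsetSum _ fun r _ => by fun_prop, Finset.mul_sum]
        exact Finset.sum_le_sum fun r _ => lintegral_inner_le hρ _
    _ = _ := by
        rw [lintegral_const_mul _ (by fun_prop), lintegral_finsetSum _ fun r _ => by fun_prop]
        simp [hν, mul_comm]

end Moments

-- Regular conditional laws of the mechanism.

section Conditional

variable {D S T : Type*} [MeasurableSpace D] [MeasurableSpace S] [StandardBorelSpace S] [Nonempty S]
  [MeasurableSpace T] {d ℓ : ℕ}

/-- Regular conditional law of a function of `Y` and independent noise. -/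
lemma condDistrib_map_prod {E N Z : Type*} [MeasurableSpace E] [StandardBorelSpace E] [Nonempty E]
    [MeasurableSpace N] [MeasurableSpace Z] [StandardBorelSpace Z] [Nonempty Z]
    (P : Measure D) [IsFiniteMeasure P] (η : Measure N) [IsProbabilityMeasure η]
    {w : D → T} (hw : Measurable w) {Y : D → E} (hY : Measurable Y)
    {Ψ : E × N → Z} (hΨ : Measurable Ψ) :
    condDistrib (fun p : D × N => Ψ (Y p.1, p.2)) (fun p : D × N => w p.1) (P.prod η)
      =ᵐ[P.map w] (condDistrib Y w P ×ₖ Kernel.const T η).map Ψ := by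
  have hmap : (P.prod η).map (fun p : D × N => w p.1) = P.map w := by
    change (P.prod η).map (w ∘ Prod.fst) = _
    rw [← Measure.map_map hw measurable_fst, Measure.map_fst_prod]
    simp
  rw [← hmap]
  have : IsMarkovKernel ((condDistrib Y w P ×ₖ Kernel.const T η).map Ψ) :=
    Kernel.IsMarkovKernel.map _ hΨ
  -- A regular conditional law is determined almost everywhere by the joint law, which is tested
  -- against nonnegative measurable `h`.
  refine condDistrib_ae_eq_of_measure_eq_compProd _ (by fun_prop) ?_
  rw [hmap, Measure.compProd_map hΨ]
  refine Measure.ext_of_lintegral _ fun h hh => ?_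
  rw [lintegral_map hh (by fun_prop), lintegral_map hh (by fun_prop),
    Measure.lintegral_compProd (by fun_prop), lintegral_prod _ (by fun_prop)]
  have hH : Measurable fun q : T × E => ∫⁻ n, h (q.1, Ψ (q.2, n)) ∂η :=
    Measurable.lintegral_prod_right' (f := fun q : (T × E) × N => h (q.1.1, Ψ (q.1.2, q.2)))
      (by fun_prop)
  calc ∫⁻ x, ∫⁻ n, h (w x, Ψ (Y x, n)) ∂η ∂P
      = ∫⁻ q, (∫⁻ n, h (q.1, Ψ (q.2, n)) ∂η) ∂(P.map fun x => (w x, Y x)) := by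
        rw [lintegral_map hH (by fun_prop)]
    _ = ∫⁻ c, ∫⁻ y, ∫⁻ n, h (c, Ψ (y, n)) ∂η ∂(condDistrib Y w P c) ∂(P.map w) := by
        rw [← compProd_map_condDistrib hY.aemeasurable, Measure.lintegral_compProd hH]
    _ = _ := by
        refine lintegral_congr fun c => ?_
        rw [Kernel.prod_apply, Kernel.const_apply, lintegral_prod _ (by fun_prop)]
        rfl

/-- Realises database and output on the product space of independent `X`, `A` and `Z`, where
conditional laws can be computed. -/
lemma compProd_projectedGaussianMechanism (P : Measure D) [IsProbabilityMeasure P]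
    {f : D → EuclideanSpace ℝ (Fin d)} (hf : Measurable f)
    (ν : Measure (Matrix (Fin d) (Fin ℓ) ℝ)) [IsProbabilityMeasure ν] (σ : ℝ) :
    P ⊗ₘ projectedGaussianMechanism f hf ν σ =
      (P.prod (ν.prod (isotropicGaussian ℓ σ))).map fun p => (p.1, projectedOutput f p) := by
  have hm := measurable_projectedOutput (ℓ := ℓ) hf
  refine Measure.ext_of_lintegral _ fun h hh => ?_
  rw [Measure.lintegral_compProd hh, lintegral_map hh (by fun_prop), lintegral_prod _ (by fun_prop)]
  refine lintegral_congr fun x => ?_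
  rw [projectedGaussianMechanism, Kernel.map_apply _ hm, lintegral_map (by fun_prop) hm,
    Kernel.prod_apply, Kernel.const_apply, Kernel.id_apply, lintegral_prod _ (by fun_prop),
    lintegral_dirac' _ (Measurable.lintegral_prod_right'
      (f := fun q : D × (Matrix (Fin d) (Fin ℓ) ℝ × EuclideanSpace ℝ (Fin ℓ)) =>
        h (x, projectedOutput f q)) (by fun_prop))]

lemma map_fst_compProd_projectedGaussianMechanism (P : Measure D) [IsProbabilityMeasure P]
    {f : D → EuclideanSpace ℝ (Fin d)} (hf : Measurable f)
    (ν : Measure (Matrix (Fin d) (Fin ℓ) ℝ)) [IsProbabilityMeasure ν] (σ : ℝ)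
    {w : D → T} (hw : Measurable w) :
    (P ⊗ₘ projectedGaussianMechanism f hf ν σ).map (fun p => w p.1) = P.map w := by
  change (P ⊗ₘ projectedGaussianMechanism f hf ν σ).map (w ∘ Prod.fst) = _
  rw [← Measure.map_map hw measurable_fst]
  congr 1
  exact Measure.fst_compProd _ _

/-- The regular conditional law of the private value and the output of the mechanism given the
public value is that of a Gaussian channel with input `Aᵀ f(X)`. -/
lemma condDistrib_projectedGaussianMechanism (P : Measure D) [IsProbabilityMeasure P]
    {g : D → S} (hg : Measurable g) {w : D → T} (hw : Measurable w)
    {f : D → EuclideanSpace ℝ (Fin d)} (hf : Measurable f)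
    (ν : Measure (Matrix (Fin d) (Fin ℓ) ℝ)) [IsProbabilityMeasure ν] (σ : ℝ) :
    ∀ᵐ c ∂(P.map w), condDistrib (fun p : D × EuclideanSpace ℝ (Fin ℓ) => (g p.1, p.2))
        (fun p => w p.1) (P ⊗ₘ projectedGaussianMechanism f hf ν σ) c =
      (((condDistrib (fun x => (g x, f x)) w P c).prod ν).prod (isotropicGaussian ℓ σ)).map
        fun p => (p.1.1.1, projectVec p.1.2 p.1.1.2 + p.2) := by
  have hm := measurable_projectedOutput (ℓ := ℓ) hf
  have h1 := condDistrib_map (ν := P.prod (ν.prod (isotropicGaussian ℓ σ)))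
    (f := fun p => (p.1, projectedOutput f p))
    (X := fun p : D × EuclideanSpace ℝ (Fin ℓ) => w p.1)
    (Y := fun p : D × EuclideanSpace ℝ (Fin ℓ) => (g p.1, p.2))
    (by fun_prop) (by fun_prop) (by fun_prop)
  have hmap : (P.prod (ν.prod (isotropicGaussian ℓ σ))).map
      ((fun p : D × EuclideanSpace ℝ (Fin ℓ) => w p.1) ∘ fun p => (p.1, projectedOutput f p)) =
      P.map w := by
    change (P.prod (ν.prod (isotropicGaussian ℓ σ))).map (w ∘ Prod.fst) = _
    rw [← Measure.map_map hw measurable_fst, Measure.map_fst_prod]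
    simp
  rw [hmap] at h1
  have h2 := condDistrib_map_prod P (ν.prod (isotropicGaussian ℓ σ)) hw
    (Y := fun x => (g x, f x)) (by fun_prop)
    (Ψ := fun q : (S × EuclideanSpace ℝ (Fin d)) ×
        (Matrix (Fin d) (Fin ℓ) ℝ × EuclideanSpace ℝ (Fin ℓ)) =>
      (q.1.1, projectVec q.2.1 q.1.2 + q.2.2)) (by fun_prop)
  filter_upwards [h1, h2] with c hc1 hc2
  simp only [compProd_projectedGaussianMechanism]
  rw [hc1]
  refine hc2.trans ?_
  rw [Kernel.map_apply _ (by fun_prop), Kernel.prod_apply, Kernel.const_apply,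
    ← Measure.prodAssoc_prod, Measure.map_map (by fun_prop) (by fun_prop)]
  rfl

-- Calibration of the output variance and the leakage bound.

/-- With `E = e^{2ε/ℓ}` the summands are `ℓ/2 (2ε/ℓ + 1/E - 1)` and `ℓ/2 (1 - 1/E)`. -/
lemma ofReal_leakage_eq (hℓ : (0 : ℝ) < ℓ) {s : ℝ} (hs : 0 < s) {ε : ℝ} (hε : 0 < ε) :
    ENNReal.ofReal (ℓ / 2 * (Real.log (s * Real.exp (2 * ε / ℓ) / s) +
        s / (s * Real.exp (2 * ε / ℓ)) - 1)) +
      ENNReal.ofReal (1 / (2 * (s * Real.exp (2 * ε / ℓ)))) *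
        (ℓ * (ENNReal.ofReal s * ENNReal.ofReal (Real.exp (2 * ε / ℓ) - 1))) =
      ENNReal.ofReal ε := by
  set E := Real.exp (2 * ε / ℓ) with hE
  have hE0 : 0 < E := Real.exp_pos _
  have hE1 : 0 < E - 1 := sub_pos.2 (Real.one_lt_exp_iff.2 (by positivity))
  have hlog : Real.log (s * E / s) = 2 * ε / ℓ := by
    rw [mul_div_cancel_left₀ _ hs.ne', hE, Real.log_exp]
  -- Without this, `ENNReal.ofReal` could truncate the first summand; it is `log x ≥ 1 - 1/x`.
  have hnonneg : 0 ≤ Real.log (s * E / s) + s / (s * E) - 1 := by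
    have h := Real.one_sub_inv_le_log_of_pos (x := s * E / s) (by positivity)
    rw [inv_div] at h
    linarith
  rw [← ENNReal.ofReal_natCast, ← ENNReal.ofReal_mul hs.le, ← ENNReal.ofReal_mul hℓ.le,
    ← ENNReal.ofReal_mul (by positivity), ← ENNReal.ofReal_add (by positivity) (by positivity),
    hlog]
  congr 1
  field_simp
  ring

/-- The mechanism leaks at most `ε` nats if `Aᵀ f(X)` has small mean squared deviation from a
function of the public value. -/
lemma condMutualInfo_projectedGaussianMechanism_le (P : Measure D) [IsProbabilityMeasure P]
    {g : D → S} (hg : Measurable g) {w : D → T} (hw : Measurable w)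
    {f : D → EuclideanSpace ℝ (Fin d)} (hf : Measurable f)
    (ν : Measure (Matrix (Fin d) (Fin ℓ) ℝ)) [IsProbabilityMeasure ν] {σ ε : ℝ} (hε : 0 < ε)
    (hℓ : 0 < ℓ) {m : T → EuclideanSpace ℝ (Fin ℓ)} (hm : Measurable m)
    (hdev : ∫⁻ x, ∫⁻ y, ∫⁻ A, ‖projectVec A y - m (w x)‖ₑ ^ 2 ∂ν ∂(condDistrib f w P (w x)) ∂P ≤
      ℓ * (ENNReal.ofReal (σ ^ 2) * ENNReal.ofReal (Real.exp (2 * ε / ℓ) - 1))) :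
    condMutualInfo (fun p : D × EuclideanSpace ℝ (Fin ℓ) => g p.1) (fun p => p.2)
      (fun p => w p.1) (P ⊗ₘ projectedGaussianMechanism f hf ν σ) ≤ ENNReal.ofReal ε := by
  set v : T → ℝ≥0∞ := fun c =>
    ∫⁻ y, ∫⁻ A, ‖projectVec A y - m c‖ₑ ^ 2 ∂ν ∂(condDistrib f w P c) with hv
  have hinner : Measurable fun q : T × EuclideanSpace ℝ (Fin d) =>
      ∫⁻ A, ‖projectVec A q.2 - m q.1‖ₑ ^ 2 ∂ν :=
    Measurable.lintegral_prod_right' (f := fun q : (T × EuclideanSpace ℝ (Fin d)) ×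
      Matrix (Fin d) (Fin ℓ) ℝ => ‖projectVec q.2 q.1.2 - m q.1.1‖ₑ ^ 2) (by fun_prop)
  have hvm : Measurable v := Measurable.lintegral_kernel_prod_right' hinner
  have hvint : ∫⁻ c, v c ∂(P.map w) ≤
      ℓ * (ENNReal.ofReal (σ ^ 2) * ENNReal.ofReal (Real.exp (2 * ε / ℓ) - 1)) := by
    rw [lintegral_map hvm hw]; exact hdev
  -- The deviation is stated for the conditional law of `f`, while the channel uses that of `(g,
  -- f)`; the marginals agree almost everywhere.
  have hsnd : condDistrib f w P =ᵐ[P.map w]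
      (condDistrib (fun x => (g x, f x)) w P).map Prod.snd :=
    condDistrib_comp w (Y := fun x => (g x, f x)) (by fun_prop) measurable_snd
  have hv' : ∀ᵐ c ∂(P.map w), ∫⁻ p, ‖projectVec p.2 p.1.2 - m c‖ₑ ^ 2
      ∂((condDistrib (fun x => (g x, f x)) w P c).prod ν) = v c := by
    filter_upwards [hsnd] with c hc
    have hi : Measurable fun y : EuclideanSpace ℝ (Fin d) =>
      ∫⁻ A, ‖projectVec A y - m c‖ₑ ^ 2 ∂ν :=
      Measurable.lintegral_prod_right' (f := fun q : EuclideanSpace ℝ (Fin d) ×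
        Matrix (Fin d) (Fin ℓ) ℝ => ‖projectVec q.2 q.1 - m c‖ₑ ^ 2) (by fun_prop)
    rw [hv]
    simp only
    rw [hc, Kernel.map_apply _ measurable_snd, lintegral_map hi measurable_snd,
      lintegral_prod _ (by fun_prop)]
  have hlaw := condDistrib_projectedGaussianMechanism P hg hw hf ν σ
  rw [condMutualInfo, map_fst_compProd_projectedGaussianMechanism P hf ν σ hw]
  have hℓ' : (0 : ℝ) < ℓ := by exact_mod_cast hℓ
  -- Without noise the hypothesis forces zero deviation, so the output is almost surely a function
  -- of the public value.
  by_cases hσ : σ = 0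
  · subst hσ
    have hv0 : v =ᵐ[P.map w] 0 := by
      rw [← lintegral_eq_zero_iff hvm]
      simpa using hvint
    refine le_trans (le_of_eq ?_) zero_le
    rw [← lintegral_zero (μ := P.map w)]
    refine lintegral_congr_ae ?_
    filter_upwards [hlaw, hv', hv0] with c hc hvc hvc0
    rw [hc]
    refine mutualInfo_gaussianChannel_of_ae_const
      ((condDistrib (fun x => (g x, f x)) w P c).prod ν) (U := fun p => p.1.1)
      (Y := fun p => projectVec p.2 p.1.2) (m := m c) (by fun_prop) ?_ 0
    rw [hvc0, Pi.zero_apply, lintegral_eq_zero_iff (by fun_prop)] at hvc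
    filter_upwards [hvc] with p hp
    simpa [sub_eq_zero] using hp
  · have hσ2 : 0 < σ ^ 2 := by positivity
    -- This is noise variance plus the permitted mean deviation per coordinate: `τ² = σ² + σ²
    -- (e^{2ε/ℓ} - 1)`.
    set τ := Real.sqrt (σ ^ 2 * Real.exp (2 * ε / ℓ)) with hτ
    have hτ2 : τ ^ 2 = σ ^ 2 * Real.exp (2 * ε / ℓ) := Real.sq_sqrt (by positivity)
    have hτ0 : τ ≠ 0 := by rw [hτ]; positivity
    set C := ℓ / 2 * (Real.log (τ ^ 2 / σ ^ 2) + σ ^ 2 / τ ^ 2 - 1) with hC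
    calc ∫⁻ c, mutualInfo (condDistrib (fun p : D × EuclideanSpace ℝ (Fin ℓ) => (g p.1, p.2))
          (fun p => w p.1) (P ⊗ₘ projectedGaussianMechanism f hf ν σ) c) ∂(P.map w)
        ≤ ∫⁻ c, (ENNReal.ofReal C + ENNReal.ofReal (1 / (2 * τ ^ 2)) * v c) ∂(P.map w) := by
          refine lintegral_mono_ae ?_
          filter_upwards [hlaw, hv'] with c hc hvc
          rw [hc, ← hvc]
          exact mutualInfo_gaussianChannel_le
            ((condDistrib (fun x => (g x, f x)) w P c).prod ν) (U := fun p => p.1.1)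
            (Y := fun p => projectVec p.2 p.1.2) (by fun_prop) (by fun_prop) (m c) hσ hτ0
      _ = ENNReal.ofReal C + ENNReal.ofReal (1 / (2 * τ ^ 2)) * ∫⁻ c, v c ∂(P.map w) := by
          have := Measure.isProbabilityMeasure_map (μ := P) hw.aemeasurable
          rw [lintegral_add_left measurable_const, lintegral_const_mul _ hvm]
          simp
      _ ≤ ENNReal.ofReal C + ENNReal.ofReal (1 / (2 * τ ^ 2)) *
          (ℓ * (ENNReal.ofReal (σ ^ 2) * ENNReal.ofReal (Real.exp (2 * ε / ℓ) - 1))) := by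
          gcongr
      _ = ENNReal.ofReal ε := by
          rw [hC, hτ2]
          exact ofReal_leakage_eq hℓ' hσ2 hε

end Conditional

end PufferfishMI

-- The two noise calibrations.

theorem mainTheorem7 {𝒳 : Type*} [MeasurableSpace 𝒳] {n k : ℕ}
    {ι κ : Type*} [Finite ι] [Finite κ]
    {S : ι → Type*} [∀ i, MeasurableSpace (S i)] [∀ i, StandardBorelSpace (S i)]
    [∀ i, Nonempty (S i)] {T : κ → Type*} [∀ j, MeasurableSpace (T j)]
    (g : ∀ i, Database 𝒳 n k → S i) (hg : ∀ i, Measurable (g i))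
    (w : ∀ j, Database 𝒳 n k → T j) (hw : ∀ j, Measurable (w j))
    (E : ι → κ → Prop) (Θ : Set (ProbabilityMeasure (Database 𝒳 n k)))
    (ε : ℝ) (hε : 0 < ε) {d ℓ : ℕ} (hℓ : 0 < ℓ) (hℓd : ℓ ≤ d)
    (f : Database 𝒳 n k → EuclideanSpace ℝ (Fin d)) (hf : Measurable f)
    (hmom : ∀ P ∈ Θ, ∀ j ∈ activePublic E,
      HasCondSecondMoment (P : Measure _) f (w j))
    (σ : ℝ) :
    (∀ A : Matrix (Fin d) (Fin ℓ) ℝ,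
      (⨆ P ∈ Θ, ⨆ j ∈ activePublic E,
          (∫⁻ x, opENorm (condCovariance
            (P : Measure _) f (w j) (w j x)) ∂P)
            * (⨆ r : Fin ℓ, ‖column A r‖ₑ ^ 2)
            / ENNReal.ofReal (Real.exp (2 * ε / ℓ) - 1)) ≤ ENNReal.ofReal (σ ^ 2) →
      IsMIPP g w E Θ ε
        (projectedGaussianMechanism f hf (Measure.dirac A) σ)) ∧
    (∀ (ν : Measure (Matrix (Fin d) (Fin ℓ) ℝ)) [IsProbabilityMeasure ν],
      (∀ r, ∫ A, ‖column A r‖ ^ 2 ∂ν = 1) →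
      (∀ r, ∫ A, column A r ∂ν = 0) →
      (⨆ P ∈ Θ, ⨆ j ∈ activePublic E,
          (∫⁻ x, (opENorm (condCovariance
              (P : Measure _) f (w j) (w j x))
            + ‖condMean
              (P : Measure _) f (w j) (w j x)‖ₑ ^ 2) ∂P)
            / ENNReal.ofReal (Real.exp (2 * ε / ℓ) - 1)) ≤ ENNReal.ofReal (σ ^ 2) →
      IsMIPP g w E Θ ε
        (projectedGaussianMechanism f hf ν σ)) := by
  have hℓ' : (0 : ℝ) < ℓ := by exact_mod_cast hℓ
  have hE : 0 < Real.exp (2 * ε / ℓ) - 1 :=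
    sub_pos.2 (Real.one_lt_exp_iff.2 (by positivity))
  have hE0 : ENNReal.ofReal (Real.exp (2 * ε / ℓ) - 1) ≠ 0 := by simpa using hE
  refine ⟨fun A hA => ?_, fun ν _ hν _ hA => ?_⟩
  · refine iSup₂_le fun P hP => iSup_le fun i => iSup_le fun j => iSup_le fun hij => ?_
    have hj : j ∈ activePublic E := ⟨i, hij⟩
    have hbound := (le_iSup₂_of_le P hP (le_iSup₂_of_le j hj le_rfl)).trans hA
    rw [ENNReal.div_le_iff hE0 ENNReal.ofReal_ne_top] at hbound
    have hmean : Measurable (condMean (P : Measure (Database 𝒳 n k)) f (w j)) :=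
      (StronglyMeasurable.integral_condDistrib
        (stronglyMeasurable_id.comp_measurable measurable_snd)).measurable
    refine condMutualInfo_projectedGaussianMechanism_le (P : Measure (Database 𝒳 n k)) (hg i) (hw j)
      hf (Measure.dirac A) hε hℓ
      (m := fun c => projectVec A (condMean (P : Measure (Database 𝒳 n k)) f (w j) c))
      (by fun_prop) ?_
    -- A finite constant leaves the integral with no measurability required of the conditional
    -- covariance norm.
    have hM : (⨆ r : Fin ℓ, ‖column A r‖ₑ ^ 2) ≠ ∞ :=
      iSup_ne_top fun r => ENNReal.pow_ne_top enorm_ne_top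
    calc _ ≤ ∫⁻ x, ℓ * (⨆ r : Fin ℓ, ‖column A r‖ₑ ^ 2) *
          opENorm (condCovariance (P : Measure (Database 𝒳 n k)) f (w j) (w j x))
            ∂(P : Measure (Database 𝒳 n k)) := by
          refine lintegral_mono_ae ?_
          filter_upwards [hmom P hP j hj] with x hx
          refine le_trans (le_of_eq (lintegral_congr fun y => ?_))
            (lintegral_projectVec_sub_mean_le hx A)
          rw [lintegral_dirac' _ (by fun_prop)]
          rfl
      _ = ℓ * ((∫⁻ x, opENorm (condCovariance (P : Measure (Database 𝒳 n k)) f (w j) (w j x))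
            ∂(P : Measure (Database 𝒳 n k))) * ⨆ r : Fin ℓ, ‖column A r‖ₑ ^ 2) := by
          rw [lintegral_const_mul' _ _ (ENNReal.mul_ne_top (ENNReal.natCast_ne_top ℓ) hM)]
          ring
      _ ≤ _ := by gcongr
  · refine iSup₂_le fun P hP => iSup_le fun i => iSup_le fun j => iSup_le fun hij => ?_
    have hj : j ∈ activePublic E := ⟨i, hij⟩
    have hbound := (le_iSup₂_of_le P hP (le_iSup₂_of_le j hj le_rfl)).trans hA
    rw [ENNReal.div_le_iff hE0 ENNReal.ofReal_ne_top] at hbound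
    have hν' : ∀ r, ∫⁻ A, ‖column A r‖ₑ ^ 2 ∂ν = 1 := by
      intro r
      have hint : Integrable (fun A => ‖column A r‖ ^ 2) ν :=
        Integrable.of_integral_ne_zero (by rw [hν r]; exact one_ne_zero)
      have h := ofReal_integral_eq_lintegral_ofReal hint
        (Filter.Eventually.of_forall fun _ => by positivity)
      rw [hν r, ENNReal.ofReal_one] at h
      simp_rw [h, ENNReal.ofReal_pow (norm_nonneg _), ofReal_norm]
    -- The centre is `0`, the conditional mean of `Aᵀ f(X)` for a centred `A` independent of `X`.
    refine condMutualInfo_projectedGaussianMechanism_le (P : Measure (Database 𝒳 n k)) (hg i) (hw j)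
      hf ν hε hℓ (m := fun _ => 0) measurable_const ?_
    simp_rw [sub_zero]
    calc _ ≤ ∫⁻ x, ℓ * (opENorm (condCovariance (P : Measure (Database 𝒳 n k)) f (w j) (w j x)) +
            ‖condMean (P : Measure (Database 𝒳 n k)) f (w j) (w j x)‖ₑ ^ 2)
            ∂(P : Measure (Database 𝒳 n k)) := by
          refine lintegral_mono_ae ?_
          filter_upwards [hmom P hP j hj] with x hx
          exact lintegral_projectVec_le hx ν hν'
      _ ≤ _ := by
          rw [lintegral_const_mul' _ _ (ENNReal.natCast_ne_top ℓ)]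
          gcongr
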